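/- **Setting.** Let $r\ge 0$ and let $\mathbf m=[m_0<\dots<m_r]$, $\mathbf n=[n_0<\dots<n_r]$ be strictly increasing sequences of non-negative integers with $m_k\mid m_{k+1}$ and $n_k\mid n_{k+1}$ for $0\le k<r$. Put $m_{-1}=n_{-1}:=-1$. Let $a<b$, $c<d$ with $b-a=d-c=h$. All norms of functions are sup norms, over $[a,b]$ or over $[a,b]\times[c,d]$. *Univariate projectors.* For integers $N\ge n\ge 0$ let $B^n_j(x)=\binom nj\big(\tfrac{b-x}{b-a}\big)^{n-j}\big(\tfrac{x-a}{b-a}\big)^j$ be the Bernstein basis of the space $\Pi_n$ of polynomials of degree at most $n$ on $[a,b]$, let $x^n_i=a+\tfrac in(b-a)$, $0\le i\le n$ (with $x^0_0=a$), and let $T_n=[B^n_j(x^n_i)]_{i,j=0}^n$. Define functionals on $C[a,b]$ by $\lambda^n_i f=\sum_{j}(T_n^{-1})_{ij}f(x^n_j)$; then $\lambda_i^nB_j^n=\delta_{ij}$. If $n=m_k$ and $N=m_r$, let $\alpha_i=iN/n$, $0\le i\le n$ (with $\alpha_0=0$ if $n=0$), let $E(\alpha,:)=[\lambda^N_{\alpha_i}B^n_j]_{i,j=0}^n$,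 and let $[D_0,\dots,D_n]=[B^n_0,\dots,B^n_n]\,E(\alpha,:)^{-1}$ be the basis of $\Pi_n$ dual to $\lambda^N_{\alpha_0},\dots,\lambda^N_{\alpha_n}$. Set $P_{m_k}f=\sum_{i}(\lambda^N_{\alpha_i}f)\,D_i$. The projectors $Q_{n_k}$ on $C[c,d]$ are defined in the same way from $n_k$ and $n_r$. Let $$C_{N,n}:=\|T_N^{-1}\|_\infty\,(n+1)\,\|E(\alpha,:)^{-1}\|_\infty ,$$ with the maximal-row-sum norm; it depends only on $N$ and $n$, not on the interval. Put $C_{m_r,m_{-1}}=C_{n_r,n_{-1}}:=0$. *Blended projector.* On $C([a,b]\times[c,d])$ let $\mathbf P_{m_k}=P_{m_k}\times I$ act in the first variable and $\mathbf Q_{n_k}=I\times Q_{n_k}$ in the second, and put $\mathbf P_{m_{-1}}=\mathbf Q_{n_{-1}}:=0$. The Boolean sum of two operators is $\mathbf A\oplus\mathbf B=\mathbf A+\mathbf B-\mathbf A\mathbf B$, and $$\mathbf B_{\mathbf m,\mathbf n}:=\mathbf P_{m_0}\mathbf Q_{n_r}\oplus\mathbf P_{m_1}\mathbf Q_{n_{r-1}}\oplus\dots\oplus\mathbf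 P_{m_r}\mathbf Q_{n_0}.$$ **Theorem.** Let $F\in C^{m_r+1,n_r+1}([a,b]\times[c,d])$, i.e. the mixed derivatives $F^{(i,j)}$ exist and are continuous on $[a,b]\times[c,d]$ for $0\le i\le m_r+1$, $0\le j\le n_r+1$. For $-1\le k,\ell\le r$ put $$K_{m_k,n_\ell}(F):=\big(1+\|\mathbf P_{m_k}\oplus\mathbf Q_{n_\ell}\|\big)\,\frac{\|F^{(m_k+1,n_\ell+1)}\|_\infty}{2^{m_k+n_\ell+2}\,(m_k+1)!\,(n_\ell+1)!},$$ where $\|\mathbf P_{m_k}\oplus\mathbf Q_{n_\ell}\|$ is the operator norm on $C([a,b]\times[c,d])$. If $h\le1$, then $$\|F-\mathbf B_{\mathbf m,\mathbf n}F\|_\infty\le C_{\mathbf m,\mathbf n}(F)\,h^p,\qquad p=\min\{m_{k-1}+n_{r-k}+2:\ k=0,\dots,r+1\},$$ with the constant $$C_{\mathbf m,\mathbf n}(F)=\sum_{k=0}^{r+1}K_{m_{k-1},n_{r-k}}(F)+\sum_{k=0}^{r}K_{m_k,n_{r-k}}(F).$$ Moreover (for every $h>0$), for all $-1\le k,\ell\le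 r$, $$\|\mathbf P_{m_k}\oplus\mathbf Q_{n_\ell}\|\le C_{m_r,m_k}+C_{n_r,n_\ell}+C_{m_r,m_k}\,C_{n_r,n_\ell}.$$ -/

import Mathlib

open Set

noncomputable section

namespace DiscreteBlending

/-! ### Univariate projectors on an interval -/

/-- The Bernstein basis polynomial `B_j^n`, scaled to `[a,b]`, as a continuous function. -/
def bern (a b : ℝ) (n j : ℕ) : C(Icc a b, ℝ) where
  toFun x := (n.choose j : ℝ) * ((b - x) / (b - a)) ^ (n - j) * ((x - a) / (b - a)) ^ j
  continuous_toFun := by fun_prop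

/-- The uniform node `a + (i/n)(b-a)`; for `n = 0` the only node is `a`. -/
def node {a b : ℝ} (hab : a < b) (n : ℕ) (i : Fin (n + 1)) : Icc a b :=
  ⟨a + ((i : ℕ) : ℝ) / (n : ℝ) * (b - a), by
    have h0 : 0 ≤ ((i : ℕ) : ℝ) / (n : ℝ) := by positivity
    have h1 : ((i : ℕ) : ℝ) / (n : ℝ) ≤ 1 := by
      apply div_le_one_of_le₀ _ (by positivity)
      exact_mod_cast Nat.lt_succ_iff.mp i.isLt
    have h2 : 0 < b - a := sub_pos.mpr hab
    constructor <;> nlinarith⟩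

/-- The collocation matrix `T_n = [B_j^n(x_i^n)]`. -/
def colloc {a b : ℝ} (hab : a < b) (n : ℕ) : Matrix (Fin (n + 1)) (Fin (n + 1)) ℝ :=
  Matrix.of fun i j => bern a b n j (node hab n i)

/-- The functional `λ_i^n = ∑_j (T_n⁻¹)_{ij} δ_{x_j^n}` on `C[a,b]`. -/
def dualFun {a b : ℝ} (hab : a < b) (n : ℕ) (i : Fin (n + 1)) : C(Icc a b, ℝ) →L[ℝ] ℝ :=
  ∑ j, (colloc hab n)⁻¹ i j • ContinuousMap.evalCLM ℝ (node hab n j)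

/-- The grid index `α_i = i N / n` (used for `n ∣ N`). -/
def gridIdx (N n : ℕ) (i : Fin (n + 1)) : Fin (N + 1) :=
  ⟨(i : ℕ) * (N / n), Nat.lt_succ_of_le
    ((Nat.mul_le_mul_right _ (Nat.lt_succ_iff.mp i.isLt)).trans (Nat.mul_div_le N n))⟩

/-- The rows `α` of the degree elevation matrix: `E(α,:)_{ij} = λ_{α_i}^N B_j^n`. -/
def elevSub {a b : ℝ} (hab : a < b) (N n : ℕ) : Matrix (Fin (n + 1)) (Fin (n + 1)) ℝ :=
  Matrix.of fun i j => dualFun hab N (gridIdx N n i) (bern a b n j)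

/-- The basis `D^n = B^n E(α,:)⁻¹` of `Π_n` dual to the functionals `λ_{α_i}^N`. -/
def dualBasis {a b : ℝ} (hab : a < b) (N n : ℕ) (i : Fin (n + 1)) : C(Icc a b, ℝ) :=
  ∑ j : Fin (n + 1), (elevSub hab N n)⁻¹ j i • bern a b n j

/-- The univariate quasi-interpolation projector `f ↦ ∑_i (λ_{α_i}^N f) D_i^n` onto `Π_n`. -/
def proj {a b : ℝ} (hab : a < b) (N n : ℕ) : C(Icc a b, ℝ) →L[ℝ] C(Icc a b, ℝ) :=
  ∑ i : Fin (n + 1), (dualFun hab N (gridIdx N n i)).smulRight (dualBasis hab N n i)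

/-- The matrix norm induced by the sup norm (maximal absolute row sum). -/
def rowSumNorm {n : ℕ} (A : Matrix (Fin n) (Fin n) ℝ) : ℝ := ⨆ i, ∑ j, |A i j|

/-- The constant `C_{N,n} = C_N (n+1) ‖E(α,:)⁻¹‖_∞` with `C_N = ‖T_N⁻¹‖_∞`.  The matrices are
those of the unit interval, so that the constant visibly depends on `N` and `n` only. -/
def projConst (N n : ℕ) : ℝ :=
  rowSumNorm (colloc (zero_lt_one' ℝ) N)⁻¹ * ((n : ℝ) + 1) *
    rowSumNorm (elevSub (zero_lt_one' ℝ) N n)⁻¹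

/-! ### Bivariate operators -/

section Extension

variable {X Y : Type*} [TopologicalSpace X] [CompactSpace X] [TopologicalSpace Y] [CompactSpace Y]

/-- The map `y ↦ F(·,y)`. -/
def sliceX (F : C(X × Y, ℝ)) : C(Y, C(X, ℝ)) := (F.comp ContinuousMap.prodSwap).curry

/-- The map `x ↦ F(x,·)`. -/
def sliceY (F : C(X × Y, ℝ)) : C(X, C(Y, ℝ)) := F.curry

theorem norm_sliceX_le (F : C(X × Y, ℝ)) (y : Y) : ‖sliceX F y‖ ≤ ‖F‖ :=
  (ContinuousMap.norm_le _ (norm_nonneg F)).2 fun x => F.norm_coe_le_norm (x, y)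

theorem norm_sliceY_le (F : C(X × Y, ℝ)) (x : X) : ‖sliceY F x‖ ≤ ‖F‖ :=
  (ContinuousMap.norm_le _ (norm_nonneg F)).2 fun y => F.norm_coe_le_norm (x, y)

/-- `P × I`: the operator `P` applied in the first variable. -/
def extX (P : C(X, ℝ) →L[ℝ] C(X, ℝ)) : C(X × Y, ℝ) →L[ℝ] C(X × Y, ℝ) :=
  LinearMap.mkContinuous
    { toFun := fun F =>
        { toFun := fun z => P (sliceX F z.2) z.1
          continuous_toFun := by fun_prop }
      map_add' := fun F G => by
        ext z
        have h : sliceX (F + G) z.2 = sliceX F z.2 + sliceX G z.2 := rfl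
        simp [h]
      map_smul' := fun t F => by
        ext z
        have h : sliceX (t • F) z.2 = t • sliceX F z.2 := rfl
        simp [h] }
    ‖P‖ fun F => (ContinuousMap.norm_le _ (by positivity)).2 fun z =>
      ((P (sliceX F z.2)).norm_coe_le_norm z.1).trans
        ((P.le_opNorm _).trans (mul_le_mul_of_nonneg_left (norm_sliceX_le F z.2) (norm_nonneg P)))

/-- `I × Q`: the operator `Q` applied in the second variable. -/
def extY (Q : C(Y, ℝ) →L[ℝ] C(Y, ℝ)) : C(X × Y, ℝ) →L[ℝ] C(X × Y, ℝ) :=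
  LinearMap.mkContinuous
    { toFun := fun F =>
        { toFun := fun z => Q (sliceY F z.1) z.2
          continuous_toFun := by fun_prop }
      map_add' := fun F G => by
        ext z
        have h : sliceY (F + G) z.1 = sliceY F z.1 + sliceY G z.1 := rfl
        simp [h]
      map_smul' := fun t F => by
        ext z
        have h : sliceY (t • F) z.1 = t • sliceY F z.1 := rfl
        simp [h] }
    ‖Q‖ fun F => (ContinuousMap.norm_le _ (by positivity)).2 fun z =>
      ((Q (sliceY F z.1)).norm_coe_le_norm z.2).trans
        ((Q.le_opNorm _).trans (mul_le_mul_of_nonneg_left (norm_sliceY_le F z.1) (norm_nonneg Q)))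

end Extension

/-- The Boolean sum `A ⊕ B = A + B - AB` of two operators. -/
def boolSum {E : Type*} [NormedAddCommGroup E] [NormedSpace ℝ E] (A B : E →L[ℝ] E) : E →L[ℝ] E :=
  A + B - A.comp B

/-- The closed rectangle `[a,b] × [c,d]`. -/
abbrev Rect (a b c d : ℝ) : Type := Icc a b × Icc c d

/-- The bivariate projector `𝐏` onto polynomials of degree at most `n` in the first variable. -/
def projX {a b c d : ℝ} (hab : a < b) (N n : ℕ) :
    C(Rect a b c d, ℝ) →L[ℝ] C(Rect a b c d, ℝ) := extX (proj hab N n)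

/-- The bivariate projector `𝐐` onto polynomials of degree at most `n` in the second variable. -/
def projY {a b c d : ℝ} (hcd : c < d) (N n : ℕ) :
    C(Rect a b c d, ℝ) →L[ℝ] C(Rect a b c d, ℝ) := extY (proj hcd N n)

variable {r : ℕ}

/-- The discretely blended projector: the iterated Boolean sum
`𝐏_{m_0}𝐐_{n_r} ⊕ 𝐏_{m_1}𝐐_{n_{r-1}} ⊕ ⋯ ⊕ 𝐏_{m_r}𝐐_{n_0}`. -/
def blend {a b c d : ℝ} (hab : a < b) (hcd : c < d) (m n : Fin (r + 1) → ℕ) :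
    C(Rect a b c d, ℝ) →L[ℝ] C(Rect a b c d, ℝ) :=
  (List.ofFn fun k : Fin (r + 1) =>
    (projX hab (m (Fin.last r)) (m k)).comp
      (projY hcd (n (Fin.last r)) (n k.rev))).foldr boolSum 0

/-! ### Quantities indexed by `k = -1, 0, …, r`

The index `k` is represented by `k + 1 : Fin (r + 2)`; thus `m_{k-1}` and `n_{r-k}`,
`0 ≤ k ≤ r + 1`, correspond to the indices `k` and `k.rev = r + 1 - k`. -/

/-- `m_k + 1`, where `m_{-1} = -1`. -/
def ord (m : Fin (r + 1) → ℕ) : Fin (r + 2) → ℕ := Fin.cons 0 fun k => m k + 1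

/-- `𝐏_{m_k}`, where `𝐏_{m_{-1}} = 0` (so that its complement `I - 𝐏_{m_{-1}}` is `I`). -/
def projXs {a b c d : ℝ} (hab : a < b) (m : Fin (r + 1) → ℕ) :
    Fin (r + 2) → C(Rect a b c d, ℝ) →L[ℝ] C(Rect a b c d, ℝ) :=
  Fin.cons 0 fun k => projX hab (m (Fin.last r)) (m k)

/-- `𝐐_{n_k}`, where `𝐐_{n_{-1}} = 0`. -/
def projYs {a b c d : ℝ} (hcd : c < d) (n : Fin (r + 1) → ℕ) :
    Fin (r + 2) → C(Rect a b c d, ℝ) →L[ℝ] C(Rect a b c d, ℝ) :=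
  Fin.cons 0 fun k => projY hcd (n (Fin.last r)) (n k)

/-- `C_{m_r,m_k}`, where `C_{m_r,m_{-1}} = 0`. -/
def projConsts (m : Fin (r + 1) → ℕ) : Fin (r + 2) → ℝ :=
  Fin.cons 0 fun k => projConst (m (Fin.last r)) (m k)

/-- The order `p = min {m_{k-1} + n_{r-k} + 2 : k = 0, …, r+1}`. -/
def approxOrder (m n : Fin (r + 1) → ℕ) : ℕ :=
  Finset.univ.inf' Finset.univ_nonempty fun k : Fin (r + 2) => ord m k + ord n k.rev

/-! ### Smoothness on a closed rectangle -/

/-- The partial derivative in the first variable (one-sided on the boundary). -/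
def partialX {a b c d : ℝ} (hab : a < b) (G : Rect a b c d → ℝ) : Rect a b c d → ℝ :=
  fun z => derivWithin (fun s => G (projIcc a b hab.le s, z.2)) (Icc a b) z.1

/-- The partial derivative in the second variable (one-sided on the boundary). -/
def partialY {a b c d : ℝ} (hcd : c < d) (G : Rect a b c d → ℝ) : Rect a b c d → ℝ :=
  fun z => derivWithin (fun t => G (z.1, projIcc c d hcd.le t)) (Icc c d) z.2

/-- The mixed derivative `G^{(i,j)}`. -/
def mixed {a b c d : ℝ} (hab : a < b) (hcd : c < d) (G : Rect a b c d → ℝ) (i j : ℕ) :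
    Rect a b c d → ℝ :=
  (partialX hab)^[i] ((partialY hcd)^[j] G)

/-- `G ∈ C^{p,q}([a,b] × [c,d])`: the mixed derivatives `G^{(i,j)}`, `i ≤ p`, `j ≤ q`, exist
(as successive derivatives of each other) and are continuous. -/
def IsCpq {a b c d : ℝ} (hab : a < b) (hcd : c < d) (p q : ℕ) (G : Rect a b c d → ℝ) : Prop :=
  (∀ i ≤ p, ∀ j ≤ q, Continuous (mixed hab hcd G i j)) ∧
  (∀ i < p, ∀ j ≤ q, ∀ z : Rect a b c d,
    HasDerivWithinAt (fun s => mixed hab hcd G i j (projIcc a b hab.le s, z.2))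
      (mixed hab hcd G (i + 1) j z) (Icc a b) z.1) ∧
  (∀ i ≤ p, ∀ j < q, ∀ z : Rect a b c d,
    HasDerivWithinAt (fun t => mixed hab hcd G i j (z.1, projIcc c d hcd.le t))
      (mixed hab hcd G i (j + 1) z) (Icc c d) z.2)

/-- The sup norm over the rectangle (applied to continuous functions only). -/
def supNorm {a b c d : ℝ} (G : Rect a b c d → ℝ) : ℝ := ⨆ z, |G z|

/-- `K_{m_k,n_l}(F) = (1 + ‖𝐏_{m_k} ⊕ 𝐐_{n_l}‖) ‖F^{(m_k+1,n_l+1)}‖_∞ /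
(2^{m_k+n_l+2} (m_k+1)! (n_l+1)!)`, for the shifted indices `k`, `l`. -/
def boolConst {a b c d : ℝ} (hab : a < b) (hcd : c < d) (m n : Fin (r + 1) → ℕ)
    (F : C(Rect a b c d, ℝ)) (k l : Fin (r + 2)) : ℝ :=
  (1 + ‖boolSum (projXs (c := c) (d := d) hab m k) (projYs (a := a) (b := b) hcd n l)‖) *
    (supNorm (mixed hab hcd F (ord m k) (ord n l)) /
      (2 ^ (ord m k + ord n l) * ((ord m k).factorial : ℝ) * ((ord n l).factorial : ℝ)))

/-- `C_{m,n}(F) = ∑_{k=0}^{r+1} K_{m_{k-1},n_{r-k}}(F) + ∑_{k=0}^{r} K_{m_k,n_{r-k}}(F)`. -/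
def blendConst {a b c d : ℝ} (hab : a < b) (hcd : c < d) (m n : Fin (r + 1) → ℕ)
    (F : C(Rect a b c d, ℝ)) : ℝ :=
  (∑ k : Fin (r + 2), boolConst hab hcd m n F k k.rev) +
    ∑ k : Fin (r + 1), boolConst hab hcd m n F k.succ k.rev.succ

end DiscreteBlending

end

/-!
The remainder `1 - P ⊕ Q = (1 - P)(1 - Q)` of a simple Boolean sum kills every function that is a
polynomial of the right degree in one of the two variables with arbitrary coefficients in the
other. Subtracting from `F` its blended Taylor polynomial at the centre of the square therefore
does not change `(1 - P)(1 - Q) F`, and what is left of `F` is bounded by its mixed derivative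
times `(h / 2) ^ M / M! * (h / 2) ^ N / N!` (`abs_blended_taylor_le`,
`norm_one_sub_mul_one_sub_le`).

The iterated Boolean sum reduces to simple ones because the projectors in each variable form a
chain, `P_k P_l = P_l P_k = P_k` for `k ≤ l`, and projectors in different variables commute: its
remainder is `∑ (1 - P_{k-1})(1 - Q_{r-k}) - ∑ (1 - P_k)(1 - Q_{r-k})` (`foldr_boolSum_ofFn`,
`one_sub_sum_mul_sub`, `one_sub_blend`).

The chain property has two halves. The range of `P_k` is reproduced by `P_l`, since `P_l`
reproduces all polynomials of its degree (`proj_aeval`). The functionals defining `P_k` are among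
those interpolated by `P_l`, because the degrees divide each other (`proj_comp_proj_of_dvd`). Both
rest on the nonsingularity of the matrices `T_N` and `E(α,:)`. With `t` the coordinate of the unit
interval, `t ^ k = ∑ i, choose i k / choose N k * B_i^N`; so multiplying by the matrix of Bernstein
coefficients of the monomials turns `T_N` into a Vandermonde matrix, and `E(α,:)` into a matrix
`choose α_i k / choose N k` that is a Vandermonde matrix of falling factorials up to column
scaling (`det_colloc_ne_zero`, `det_elevSub_ne_zero`).

The operator norm of `P` is bounded through the Bernstein coefficients of `P f`, since the
Bernstein basis is a nonnegative partition of unity (`norm_proj_le`); the bound for `P ⊕ Q`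
follows from the triangle inequality.
-/

namespace DiscreteBlending

/-! ### A Taylor estimate at an interior point -/

theorem abs_sub_taylor_le_right (M : ℕ) : ∀ (f : ℕ → ℝ → ℝ) {x₀ x₁ C : ℝ},
    (∀ i < M, ∀ t ∈ Icc x₀ x₁, HasDerivWithinAt (f i) (f (i + 1) t) (Icc x₀ x₁) t) →
    (∀ t ∈ Icc x₀ x₁, |f M t| ≤ C) → ∀ t ∈ Icc x₀ x₁,
    |f 0 t - ∑ i ∈ Finset.range M, f i x₀ * ((t - x₀) ^ i / (i.factorial : ℝ))| ≤
      C * ((t - x₀) ^ M / (M.factorial : ℝ)) := by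
  induction M with
  | zero => intro f x₀ x₁ C _ hC t ht; simpa using hC t ht
  | succ M ih =>
    intro f x₀ x₁ C hf hC
    have hpow : ∀ (i : ℕ) (t : ℝ), HasDerivAt
        (fun t : ℝ => (t - x₀) ^ (i + 1) / ((i + 1).factorial : ℝ))
        ((t - x₀) ^ i / (i.factorial : ℝ)) t := by
      intro i t
      refine ((((hasDerivAt_id t).sub_const x₀).pow (i + 1)).div_const
        ((i + 1).factorial : ℝ)).congr_deriv ?_
      have h1 : ((i.factorial : ℕ) : ℝ) ≠ 0 := by positivity
      have h2 : ((i : ℝ) + 1) ≠ 0 := by positivity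
      simp only [Nat.factorial_succ, Nat.cast_mul, Nat.cast_add, Nat.cast_one,
        Nat.add_sub_cancel, id]
      field_simp
    have hderiv : ∀ t ∈ Icc x₀ x₁, HasDerivWithinAt
        (fun t => f 0 t - ∑ i ∈ Finset.range (M + 1),
          f i x₀ * ((t - x₀) ^ i / (i.factorial : ℝ)))
        (f 1 t - ∑ i ∈ Finset.range M, f (i + 1) x₀ * ((t - x₀) ^ i / (i.factorial : ℝ)))
        (Icc x₀ x₁) t := by
      intro t ht
      refine (hf 0 M.succ_pos t ht).sub ?_
      simp only [Finset.sum_range_succ']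
      have := (HasDerivAt.fun_sum fun i (_ : i ∈ Finset.range M) =>
        (hpow i t).const_mul (f (i + 1) x₀)).add_const (f 0 x₀ * ((t - x₀) ^ 0 / 1))
      simpa using this.hasDerivWithinAt
    refine image_norm_le_of_norm_deriv_right_le_deriv_boundary
      (fun t ht => (hderiv t ht).continuousWithinAt)
      (fun t ht => (hderiv t ⟨ht.1, ht.2.le⟩).mono_of_mem_nhdsWithin
        (Filter.mem_of_superset (Icc_mem_nhdsGE ht.2) (Icc_subset_Icc_left ht.1)))
      ?_ (fun t => (hpow M t).const_mul C) fun t ht => ?_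
    · simp [Finset.sum_range_succ']
    · exact ih (fun i => f (i + 1)) (fun i hi => hf (i + 1) (by omega)) hC t ⟨ht.1, ht.2.le⟩

/-- Taylor's estimate for a chain `f 0, f 1, …, f M` of successive derivatives on `[a,b]`,
expanded at an arbitrary point of the interval. -/
theorem abs_sub_taylor_le {M : ℕ} {f : ℕ → ℝ → ℝ} {a b C x₀ : ℝ} (hx₀ : x₀ ∈ Icc a b)
    (hf : ∀ i < M, ∀ t ∈ Icc a b, HasDerivWithinAt (f i) (f (i + 1) t) (Icc a b) t)
    (hC : ∀ t ∈ Icc a b, |f M t| ≤ C) {t : ℝ} (ht : t ∈ Icc a b) :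
    |f 0 t - ∑ i ∈ Finset.range M, f i x₀ * ((t - x₀) ^ i / (i.factorial : ℝ))| ≤
      C * (|t - x₀| ^ M / (M.factorial : ℝ)) := by
  rcases le_total x₀ t with h | h
  · rw [abs_of_nonneg (sub_nonneg.2 h)]
    have hsub : Icc x₀ b ⊆ Icc a b := Icc_subset_Icc_left hx₀.1
    exact abs_sub_taylor_le_right M f (fun i hi s hs => (hf i hi s (hsub hs)).mono hsub)
      (fun s hs => hC s (hsub hs)) t ⟨h, ht.2⟩
  · -- reflect the interval `[a, x₀]` to the right of `-x₀`
    have hmem : ∀ s ∈ Icc (-x₀) (-a), -s ∈ Icc a b := fun s hs =>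
      ⟨by linarith [hs.2], by linarith [hs.1, hx₀.2]⟩
    have key := abs_sub_taylor_le_right M (fun i s => (-1) ^ i * f i (-s))
      (x₀ := -x₀) (x₁ := -a) (C := C) (fun i hi s hs => by
        have h1 := (hf i hi (-s) (hmem s hs)).scomp s
          (hasDerivAt_neg s).hasDerivWithinAt (fun u hu => hmem u hu)
        refine (h1.const_mul ((-1) ^ i)).congr_deriv ?_
        simp [pow_succ])
      (fun s hs => by simpa [abs_mul] using hC (-s) (hmem s hs))
      (-t) ⟨by linarith, by linarith [ht.1]⟩
    have e : -t - -x₀ = |t - x₀| := by rw [abs_of_nonpos (by linarith)]; ring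
    rw [← e]
    convert key using 3
    · simp
    · refine Finset.sum_congr rfl fun i _ => ?_
      have : t - x₀ = -1 * (-t - -x₀) := by ring
      rw [this, mul_pow, neg_neg]; ring

/-! ### Bernstein coefficients and nonsingularity -/

/-- The coordinate `x ↦ (x - a) / (b - a)` identifying `[a,b]` with the unit interval. -/
noncomputable def unitCoord (a b : ℝ) : C(Icc a b, ℝ) where
  toFun x := (x - a) / (b - a)
  continuous_toFun := by fun_prop

/-- The matrix of the Bernstein coefficients of the monomials: column `k` holds the
coefficients of `t ^ k` with respect to the Bernstein basis of degree `N`. -/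
noncomputable def monomialCoeff (N n : ℕ) : Matrix (Fin (N + 1)) (Fin (n + 1)) ℝ :=
  Matrix.of fun i k => ((i : ℕ).choose k : ℝ) / (N.choose k : ℝ)

theorem sum_choose_mul_bernstein {N k : ℕ} (hk : k ≤ N) (t : ℝ) :
    ∑ i ∈ Finset.range (N + 1),
      (i.choose k : ℝ) * ((N.choose i : ℝ) * (1 - t) ^ (N - i) * t ^ i) =
      (N.choose k : ℝ) * t ^ k := by
  obtain ⟨d, rfl⟩ := Nat.exists_eq_add_of_le hk
  rw [add_assoc, Finset.sum_range_add, Finset.sum_eq_zero, zero_add]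
  · have h1 : ∀ j ∈ Finset.range (d + 1), ((k + j).choose k : ℝ) *
        (((k + d).choose (k + j) : ℝ) * (1 - t) ^ (k + d - (k + j)) * t ^ (k + j)) =
        ((k + d).choose k : ℝ) * t ^ k * (t ^ j * (1 - t) ^ (d - j) * (d.choose j : ℝ)) := by
      intro j _
      have h2 := Nat.choose_mul (n := k + d) (Nat.le_add_right k j)
      simp only [Nat.add_sub_cancel_left] at h2
      have h3 : ((k + d).choose (k + j) : ℝ) * ((k + j).choose k : ℝ) =
        ((k + d).choose k : ℝ) * (d.choose j : ℝ) := by exact_mod_cast h2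
      rw [Nat.add_sub_add_left, pow_add]
      linear_combination ((1 - t) ^ (d - j) * (t ^ k * t ^ j)) * h3
    rw [Finset.sum_congr rfl h1, ← Finset.mul_sum, ← add_pow]
    simp
  · intro i hi
    simp [Nat.choose_eq_zero_of_lt (Finset.mem_range.1 hi)]

theorem bern_apply {a b : ℝ} (hab : a < b) (n j : ℕ) (x : Icc a b) :
    bern a b n j x =
      (n.choose j : ℝ) * (1 - unitCoord a b x) ^ (n - j) * unitCoord a b x ^ j := by
  have h : b - a ≠ 0 := (sub_pos.2 hab).ne'
  have h1 : 1 - ((x : ℝ) - a) / (b - a) = (b - x) / (b - a) := by field_simp; ring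
  simp [bern, unitCoord, h1]

theorem unitCoord_node {a b : ℝ} (hab : a < b) (n : ℕ) (i : Fin (n + 1)) :
    unitCoord a b (node hab n i) = ((i : ℕ) : ℝ) / (n : ℝ) := by
  have h : b - a ≠ 0 := (sub_pos.2 hab).ne'
  simp [unitCoord, node, h]

theorem unitCoord_pow_eq_sum_bern {a b : ℝ} (hab : a < b) {N n : ℕ} (hn : n ≤ N)
    (k : Fin (n + 1)) :
    unitCoord a b ^ (k : ℕ) = ∑ i : Fin (N + 1), monomialCoeff N n i k • bern a b N i := by
  have hk : (k : ℕ) ≤ N := (Nat.lt_succ_iff.1 k.2).trans hn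
  have hne : (N.choose k : ℝ) ≠ 0 := by exact_mod_cast (Nat.choose_pos hk).ne'
  ext x
  rw [ContinuousMap.sum_apply]
  simp only [ContinuousMap.pow_apply, ContinuousMap.smul_apply, bern_apply hab, monomialCoeff,
    Matrix.of_apply, smul_eq_mul, div_mul_eq_mul_div]
  rw [Fin.sum_univ_eq_sum_range (fun i => (i.choose k : ℝ) * ((N.choose i : ℝ) *
    (1 - unitCoord a b x) ^ (N - i) * unitCoord a b x ^ i) / (N.choose k : ℝ)),
    ← Finset.sum_div, sum_choose_mul_bernstein hk]
  field_simp

/-- Multiplying by the coefficients of the monomials turns the collocation matrix into a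
Vandermonde matrix. -/
theorem det_colloc_ne_zero {a b : ℝ} (hab : a < b) (n : ℕ) : (colloc hab n).det ≠ 0 := by
  have hV : colloc hab n * monomialCoeff n n =
      Matrix.vandermonde fun i : Fin (n + 1) => ((i : ℕ) : ℝ) / (n : ℝ) := by
    ext i k
    have h := congrArg (fun f : C(Icc a b, ℝ) => f (node hab n i))
      (unitCoord_pow_eq_sum_bern hab le_rfl k)
    simp only [ContinuousMap.sum_apply, ContinuousMap.pow_apply, unitCoord_node,
      ContinuousMap.smul_apply, smul_eq_mul] at h
    rw [Matrix.mul_apply, Matrix.vandermonde_apply, h]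
    exact Finset.sum_congr rfl fun j _ => mul_comm _ _
  have hinj : Function.Injective fun i : Fin (n + 1) => ((i : ℕ) : ℝ) / (n : ℝ) := by
    intro i j hij
    rcases Nat.eq_zero_or_pos n with rfl | hn
    · exact Fin.ext (by omega)
    · have hn' : (n : ℝ) ≠ 0 := by positivity
      have : ((i : ℕ) : ℝ) = ((j : ℕ) : ℝ) := (div_left_inj' hn').1 hij
      exact Fin.ext (by exact_mod_cast this)
  have := Matrix.det_vandermonde_ne_zero_iff.2 hinj
  rw [← hV, Matrix.det_mul] at this
  exact left_ne_zero_of_mul this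

theorem dualFun_apply {a b : ℝ} (hab : a < b) (n : ℕ) (i : Fin (n + 1)) (f : C(Icc a b, ℝ)) :
    dualFun hab n i f = ∑ j, (colloc hab n)⁻¹ i j * f (node hab n j) := by
  simp [dualFun]

theorem dualFun_bern {a b : ℝ} (hab : a < b) (n : ℕ) (i j : Fin (n + 1)) :
    dualFun hab n i (bern a b n j) = (1 : Matrix (Fin (n + 1)) (Fin (n + 1)) ℝ) i j := by
  rw [← Matrix.nonsing_inv_mul (colloc hab n) (isUnit_iff_ne_zero.2 (det_colloc_ne_zero hab n)),
    dualFun_apply, Matrix.mul_apply]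
  rfl

theorem dualFun_unitCoord_pow {a b : ℝ} (hab : a < b) {N n : ℕ} (hn : n ≤ N)
    (i : Fin (N + 1)) (k : Fin (n + 1)) :
    dualFun hab N i (unitCoord a b ^ (k : ℕ)) = monomialCoeff N n i k := by
  rw [unitCoord_pow_eq_sum_bern hab hn, map_sum]
  simp [dualFun_bern, Matrix.one_apply]

theorem gridIdx_injective {N n : ℕ} (hn : n ≤ N) : Function.Injective (gridIdx N n) := by
  intro i j hij
  rcases Nat.eq_zero_or_pos n with rfl | hpos
  · exact Fin.ext (by omega)
  · have : (i : ℕ) * (N / n) = j * (N / n) := congrArg Fin.val hij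
    exact Fin.ext (Nat.eq_of_mul_eq_mul_right (Nat.div_pos hn hpos) this)

/-- The Bernstein coefficient of index `i` of a polynomial of degree at most `n` is a polynomial
of degree at most `n` in `i`: for monomials it is a multiple of a falling factorial.  Hence the
rows of the degree elevation matrix at any `n + 1` distinct indices are independent. -/
theorem det_elevSub_ne_zero {a b : ℝ} (hab : a < b) {N n : ℕ} (hn : n ≤ N) :
    (elevSub hab N n).det ≠ 0 := by
  have hW : elevSub hab N n * monomialCoeff n n =
      (Matrix.of fun i j : Fin (n + 1) =>
        (descPochhammer ℝ j).eval (((gridIdx N n i : Fin (N + 1)) : ℕ) : ℝ)) *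
      Matrix.diagonal fun k : Fin (n + 1) =>
        (((k : ℕ).factorial : ℝ) * (N.choose k : ℝ))⁻¹ := by
    ext i k
    have h := dualFun_unitCoord_pow hab hn (gridIdx N n i) k
    rw [unitCoord_pow_eq_sum_bern hab le_rfl, map_sum] at h
    have hf : ((k : ℕ).factorial : ℝ) ≠ 0 := by positivity
    rw [Matrix.mul_diagonal, Matrix.of_apply, descPochhammer_eval_eq_descFactorial,
      Nat.descFactorial_eq_factorial_mul_choose, Matrix.mul_apply]
    trans monomialCoeff N n (gridIdx N n i) k
    · rw [← h]
      exact Finset.sum_congr rfl fun j _ => by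
        rw [map_smul, smul_eq_mul, mul_comm]; rfl
    · simp only [monomialCoeff, Matrix.of_apply]
      push_cast
      rw [mul_inv]
      field_simp
  have h1 : (elevSub hab N n * monomialCoeff n n).det ≠ 0 := by
    rw [hW, Matrix.det_mul, Matrix.det_diagonal,
      ← Matrix.det_eval_matrixOfPolynomials_eq_det_vandermonde
        (fun i : Fin (n + 1) => (((gridIdx N n i : Fin (N + 1)) : ℕ) : ℝ))
        (fun j : Fin (n + 1) => descPochhammer ℝ (j : ℕ))
        (fun j => descPochhammer_natDegree ℝ _) (fun j => monic_descPochhammer ℝ _)]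
    refine mul_ne_zero (Matrix.det_vandermonde_ne_zero_iff.2 fun i j hij =>
      gridIdx_injective hn (Fin.ext (by exact_mod_cast hij))) ?_
    refine Finset.prod_ne_zero_iff.2 fun k _ => inv_ne_zero (mul_ne_zero (by positivity) ?_)
    exact_mod_cast (Nat.choose_pos ((Nat.lt_succ_iff.1 k.2).trans hn)).ne'
  rw [Matrix.det_mul] at h1
  exact left_ne_zero_of_mul h1

/-! ### The univariate projectors -/

theorem proj_apply {a b : ℝ} (hab : a < b) (N n : ℕ) (f : C(Icc a b, ℝ)) :
    proj hab N n f = ∑ i : Fin (n + 1),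
      dualFun hab N (gridIdx N n i) f • dualBasis hab N n i := by
  simp [proj]

theorem proj_bern {a b : ℝ} (hab : a < b) {N n : ℕ} (hn : n ≤ N) (j : Fin (n + 1)) :
    proj hab N n (bern a b n j) = bern a b n j := by
  have hinv := Matrix.nonsing_inv_mul (elevSub hab N n)
    (isUnit_iff_ne_zero.2 (det_elevSub_ne_zero hab hn))
  rw [proj_apply]
  simp only [dualBasis, Finset.smul_sum, smul_smul]
  rw [Finset.sum_comm]
  simp only [← Finset.sum_smul]
  have h : ∀ l : Fin (n + 1), ∑ i, dualFun hab N (gridIdx N n i) (bern a b n j) *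
      (elevSub hab N n)⁻¹ l i = (1 : Matrix (Fin (n + 1)) (Fin (n + 1)) ℝ) l j := by
    intro l
    rw [← hinv, Matrix.mul_apply]
    exact Finset.sum_congr rfl fun i _ => mul_comm _ _
  simp [h, Matrix.one_apply]

theorem proj_aeval {a b : ℝ} (hab : a < b) {N n : ℕ} (hn : n ≤ N) {p : Polynomial ℝ}
    (hp : p.natDegree ≤ n) :
    proj hab N n (Polynomial.aeval (unitCoord a b) p) = Polynomial.aeval (unitCoord a b) p := by
  rw [Polynomial.aeval_eq_sum_range, map_sum]
  refine Finset.sum_congr rfl fun k hk => ?_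
  have hk' : k < n + 1 := lt_of_lt_of_le (Finset.mem_range.1 hk) (by omega)
  have h := unitCoord_pow_eq_sum_bern hab (le_refl n) ⟨k, hk'⟩
  simp only at h
  rw [map_smul, h, map_sum]
  simp only [map_smul, proj_bern hab hn]

theorem bern_eq_aeval {a b : ℝ} (hab : a < b) (n j : ℕ) :
    bern a b n j = Polynomial.aeval (unitCoord a b) (bernsteinPolynomial ℝ n j) := by
  ext x
  simp [bern_apply hab, bernsteinPolynomial]
  ring

theorem natDegree_bernsteinPolynomial_le {n j : ℕ} (hj : j ≤ n) :
    (bernsteinPolynomial ℝ n j).natDegree ≤ n := by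
  have h1 : (1 - Polynomial.X : Polynomial ℝ).natDegree ≤ 1 := by compute_degree
  have h2 : ((n.choose j : Polynomial ℝ) * Polynomial.X ^ j).natDegree ≤ j := by compute_degree
  calc _ ≤ j + (n - j) * 1 :=
        Polynomial.natDegree_mul_le_of_le h2 (Polynomial.natDegree_pow_le_of_le _ h1)
    _ = n := by omega

theorem proj_comp_proj_of_le {a b : ℝ} (hab : a < b) {N n l : ℕ} (hnl : n ≤ l) (hl : l ≤ N) :
    (proj hab N l).comp (proj hab N n) = proj hab N n := by
  ext1 f
  rw [ContinuousLinearMap.comp_apply, proj_apply hab N n, map_sum]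
  simp only [map_smul, dualBasis, map_sum]
  refine Finset.sum_congr rfl fun i _ => ?_
  congr 1
  refine Finset.sum_congr rfl fun j _ => ?_
  rw [bern_eq_aeval hab, proj_aeval hab hl
    ((natDegree_bernsteinPolynomial_le (Nat.lt_succ_iff.1 j.2)).trans hnl)]

theorem dualFun_proj {a b : ℝ} (hab : a < b) {N n : ℕ} (hn : n ≤ N) (i : Fin (n + 1))
    (f : C(Icc a b, ℝ)) :
    dualFun hab N (gridIdx N n i) (proj hab N n f) = dualFun hab N (gridIdx N n i) f := by
  have hinv := Matrix.mul_nonsing_inv (elevSub hab N n)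
    (isUnit_iff_ne_zero.2 (det_elevSub_ne_zero hab hn))
  have h : ∀ l, dualFun hab N (gridIdx N n i) (dualBasis hab N n l) =
      (1 : Matrix (Fin (n + 1)) (Fin (n + 1)) ℝ) i l := by
    intro l
    rw [← hinv, Matrix.mul_apply, dualBasis, map_sum]
    exact Finset.sum_congr rfl fun j _ => by rw [map_smul, smul_eq_mul, mul_comm]; rfl
  rw [proj_apply, map_sum]
  simp [h, Matrix.one_apply]

/-- When `n ∣ l ∣ N`, the functionals defining the projector of degree `n` are among those
interpolated by the projector of degree `l`. -/
theorem proj_comp_proj_of_dvd {a b : ℝ} (hab : a < b) {N n l : ℕ} (hnl : n ∣ l) (hlN : l ∣ N)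
    (hn : n ≤ l) (hl : l ≤ N) :
    (proj hab N n).comp (proj hab N l) = proj hab N n := by
  ext1 f
  rw [ContinuousLinearMap.comp_apply, proj_apply hab N n, proj_apply hab N n f]
  refine Finset.sum_congr rfl fun i _ => ?_
  congr 1
  have hidx : gridIdx N n i = gridIdx N l ⟨i * (l / n), Nat.lt_succ_of_le
      ((Nat.mul_le_mul_right _ (Nat.lt_succ_iff.mp i.isLt)).trans (Nat.mul_div_le l n))⟩ := by
    apply Fin.ext
    simp only [gridIdx]
    rcases Nat.eq_zero_or_pos n with rfl | hpos
    · simp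
    · rw [mul_assoc, mul_comm (l / n), Nat.div_mul_div_comm hlN hnl,
        mul_comm N, Nat.mul_div_mul_left _ _ (hpos.trans_le hn)]
  rw [hidx, dualFun_proj hab hl]

theorem proj_sub_pow {a b : ℝ} (hab : a < b) {N n i : ℕ} (hn : n ≤ N) (hi : i ≤ n) (x₀ : ℝ)
    (g : C(Icc a b, ℝ)) (hg : ∀ x, g x = ((x : ℝ) - x₀) ^ i) : proj hab N n g = g := by
  have h : b - a ≠ 0 := (sub_pos.2 hab).ne'
  have e : g = Polynomial.aeval (unitCoord a b)
      ((Polynomial.C (b - a) * Polynomial.X + Polynomial.C (a - x₀)) ^ i) := by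
    ext x
    rw [hg]
    simp only [map_pow, map_add, map_mul, Polynomial.aeval_C, Polynomial.aeval_X,
      ContinuousMap.pow_apply, ContinuousMap.add_apply, ContinuousMap.mul_apply,
      Algebra.algebraMap_eq_smul_one, ContinuousMap.smul_apply,
      ContinuousMap.one_apply, unitCoord, ContinuousMap.coe_mk, smul_eq_mul, mul_one]
    congr 1
    field_simp
    ring
  rw [e]
  refine proj_aeval hab hn (le_trans (Polynomial.natDegree_pow_le_of_le i
    Polynomial.natDegree_linear_le) (by simpa using hi))

/-! ### Norm bounds for the univariate projectors -/

theorem sum_abs_le_rowSumNorm {n : ℕ} (A : Matrix (Fin n) (Fin n) ℝ) (i : Fin n) :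
    ∑ j, |A i j| ≤ rowSumNorm A :=
  le_ciSup (f := fun i => ∑ j, |A i j|) (finite_range _).bddAbove i

theorem rowSumNorm_nonneg {n : ℕ} (A : Matrix (Fin n) (Fin n) ℝ) : 0 ≤ rowSumNorm A :=
  Real.iSup_nonneg fun _ => Finset.sum_nonneg fun _ _ => abs_nonneg _

theorem projConst_nonneg (N n : ℕ) : 0 ≤ projConst N n :=
  mul_nonneg (mul_nonneg (rowSumNorm_nonneg _) (by positivity)) (rowSumNorm_nonneg _)

theorem bern_node {a b : ℝ} (hab : a < b) (n j N : ℕ) (i : Fin (N + 1)) :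
    bern a b n j (node hab N i) = bern 0 1 n j (node (zero_lt_one' ℝ) N i) := by
  rw [bern_apply hab, bern_apply (zero_lt_one' ℝ), unitCoord_node, unitCoord_node]

theorem colloc_eq_unit {a b : ℝ} (hab : a < b) (n : ℕ) :
    colloc hab n = colloc (zero_lt_one' ℝ) n := by
  ext i j
  exact bern_node hab n j n i

theorem elevSub_eq_unit {a b : ℝ} (hab : a < b) (N n : ℕ) :
    elevSub hab N n = elevSub (zero_lt_one' ℝ) N n := by
  ext i j
  simp only [elevSub, Matrix.of_apply, dualFun_apply, bern_node hab n j N, colloc_eq_unit hab]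

theorem sum_bern {a b : ℝ} (hab : a < b) (n : ℕ) (x : Icc a b) :
    ∑ j : Fin (n + 1), bern a b n j x = 1 := by
  have h := congrArg (fun f : C(Icc a b, ℝ) => f x)
    (unitCoord_pow_eq_sum_bern hab (le_refl n) 0)
  simpa [monomialCoeff, ContinuousMap.sum_apply] using h.symm

theorem bern_nonneg {a b : ℝ} (n j : ℕ) (x : Icc a b) : 0 ≤ bern a b n j x := by
  have h1 := sub_nonneg.2 x.2.1
  have h2 := sub_nonneg.2 x.2.2
  have h3 : 0 ≤ b - a := by linarith
  simp only [bern, ContinuousMap.coe_mk]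
  positivity

theorem abs_dualFun_le {a b : ℝ} (hab : a < b) (n : ℕ) (i : Fin (n + 1)) (f : C(Icc a b, ℝ)) :
    |dualFun hab n i f| ≤ rowSumNorm (colloc hab n)⁻¹ * ‖f‖ := by
  rw [dualFun_apply]
  calc _ ≤ ∑ j, |(colloc hab n)⁻¹ i j * f (node hab n j)| := Finset.abs_sum_le_sum_abs _ _
    _ ≤ ∑ j, |(colloc hab n)⁻¹ i j| * ‖f‖ := Finset.sum_le_sum fun j _ => by
        rw [abs_mul]
        exact mul_le_mul_of_nonneg_left (f.norm_coe_le_norm _) (abs_nonneg _)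
    _ ≤ _ := by
        rw [← Finset.sum_mul]
        exact mul_le_mul_of_nonneg_right (sum_abs_le_rowSumNorm _ i) (norm_nonneg f)

theorem norm_proj_le {a b : ℝ} (hab : a < b) (N n : ℕ) : ‖proj hab N n‖ ≤ projConst N n := by
  have hT := rowSumNorm_nonneg (colloc hab N)⁻¹
  have hE := rowSumNorm_nonneg (elevSub hab N n)⁻¹
  have hle : rowSumNorm (elevSub hab N n)⁻¹ * rowSumNorm (colloc hab N)⁻¹ ≤ projConst N n := by
    have h1 : (1 : ℝ) ≤ n + 1 := by simp
    rw [projConst, ← colloc_eq_unit hab, ← elevSub_eq_unit hab, mul_right_comm,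
      mul_comm (rowSumNorm (elevSub hab N n)⁻¹)]
    exact le_mul_of_one_le_right (mul_nonneg hT hE) h1
  refine ContinuousLinearMap.opNorm_le_bound _ (projConst_nonneg N n) fun f => ?_
  refine le_trans ?_ (mul_le_mul_of_nonneg_right hle (norm_nonneg f))
  refine (ContinuousMap.norm_le _ (by positivity)).2 fun x => ?_
  -- the Bernstein coefficients of `proj hab N n f`
  have hx : proj hab N n f x = ∑ j : Fin (n + 1), (∑ i, (elevSub hab N n)⁻¹ j i *
      dualFun hab N (gridIdx N n i) f) * bern a b n j x := by
    rw [proj_apply, ContinuousMap.sum_apply]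
    simp only [ContinuousMap.smul_apply, dualBasis, ContinuousMap.sum_apply, smul_eq_mul,
      Finset.mul_sum, Finset.sum_mul]
    rw [Finset.sum_comm]
    exact Finset.sum_congr rfl fun j _ => Finset.sum_congr rfl fun i _ => by ring
  rw [hx, Real.norm_eq_abs]
  calc _ ≤ ∑ j : Fin (n + 1), |(∑ i, (elevSub hab N n)⁻¹ j i *
        dualFun hab N (gridIdx N n i) f) * bern a b n j x| := Finset.abs_sum_le_sum_abs _ _
    _ ≤ ∑ j : Fin (n + 1), rowSumNorm (elevSub hab N n)⁻¹ *
        (rowSumNorm (colloc hab N)⁻¹ * ‖f‖) * bern a b n j x := by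
        refine Finset.sum_le_sum fun j _ => ?_
        rw [abs_mul, abs_of_nonneg (bern_nonneg n j x)]
        refine mul_le_mul_of_nonneg_right ?_ (bern_nonneg n j x)
        calc _ ≤ ∑ i, |(elevSub hab N n)⁻¹ j i * dualFun hab N (gridIdx N n i) f| :=
              Finset.abs_sum_le_sum_abs _ _
          _ ≤ ∑ i, |(elevSub hab N n)⁻¹ j i| * (rowSumNorm (colloc hab N)⁻¹ * ‖f‖) :=
              Finset.sum_le_sum fun i _ => by
                rw [abs_mul]
                exact mul_le_mul_of_nonneg_left (abs_dualFun_le hab N _ f) (abs_nonneg _)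
          _ ≤ _ := by
              rw [← Finset.sum_mul]
              exact mul_le_mul_of_nonneg_right (sum_abs_le_rowSumNorm _ j) (by positivity)
    _ = _ := by rw [← Finset.mul_sum, sum_bern hab, mul_one, mul_assoc]

/-! ### Parametric extensions of univariate operators -/

section Extension

variable {X Y : Type*} [TopologicalSpace X] [CompactSpace X] [TopologicalSpace Y] [CompactSpace Y]

theorem extX_mul (P P' : C(X, ℝ) →L[ℝ] C(X, ℝ)) :
    (extX P * extX P' : C(X × Y, ℝ) →L[ℝ] C(X × Y, ℝ)) = extX (P.comp P') :=
  rfl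

theorem extY_mul (Q Q' : C(Y, ℝ) →L[ℝ] C(Y, ℝ)) :
    (extY Q * extY Q' : C(X × Y, ℝ) →L[ℝ] C(X × Y, ℝ)) = extY (Q.comp Q') :=
  rfl

theorem norm_extX_le (P : C(X, ℝ) →L[ℝ] C(X, ℝ)) :
    ‖(extX P : C(X × Y, ℝ) →L[ℝ] C(X × Y, ℝ))‖ ≤ ‖P‖ :=
  LinearMap.mkContinuous_norm_le _ (norm_nonneg P) _

theorem norm_extY_le (Q : C(Y, ℝ) →L[ℝ] C(Y, ℝ)) :
    ‖(extY Q : C(X × Y, ℝ) →L[ℝ] C(X × Y, ℝ))‖ ≤ ‖Q‖ :=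
  LinearMap.mkContinuous_norm_le _ (norm_nonneg Q) _

theorem extX_apply_of_eq_mul (P : C(X, ℝ) →L[ℝ] C(X, ℝ)) (f : C(X, ℝ)) (g : C(Y, ℝ))
    (G : C(X × Y, ℝ)) (hG : ∀ z, G z = f z.1 * g z.2) (hf : P f = f) : extX P G = G := by
  ext z
  have h : sliceX G z.2 = g z.2 • f := by
    ext x
    exact (hG (x, z.2)).trans (mul_comm _ _)
  change P (sliceX G z.2) z.1 = G z
  rw [h, map_smul, hf, hG, ContinuousMap.smul_apply, smul_eq_mul, mul_comm]

theorem extY_apply_of_eq_mul (Q : C(Y, ℝ) →L[ℝ] C(Y, ℝ)) (f : C(X, ℝ)) (g : C(Y, ℝ))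
    (G : C(X × Y, ℝ)) (hG : ∀ z, G z = f z.1 * g z.2) (hg : Q g = g) : extY Q G = G := by
  ext z
  have h : sliceY G z.1 = f z.1 • g := by
    ext y
    exact hG (z.1, y)
  change Q (sliceY G z.1) z.2 = G z
  rw [h, map_smul, hg, hG, ContinuousMap.smul_apply, smul_eq_mul]

end Extension

/-- Since `proj` uses only finitely many point values, its parametric extension commutes with
that of any operator acting in the other variable. -/
theorem projX_mul_extY {a b c d : ℝ} (hab : a < b) (N n : ℕ)
    (Q : C(Icc c d, ℝ) →L[ℝ] C(Icc c d, ℝ)) :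
    (projX hab N n * extY Q : C(Rect a b c d, ℝ) →L[ℝ] C(Rect a b c d, ℝ)) =
      extY Q * projX hab N n := by
  have hw : ∀ (f : C(Icc a b, ℝ)) (x : Icc a b), proj hab N n f x =
      ∑ i : Fin (n + 1), ∑ j, (dualBasis hab N n i x *
        (colloc hab N)⁻¹ (gridIdx N n i) j) * f (node hab N j) := by
    intro f x
    rw [proj_apply, ContinuousMap.sum_apply]
    refine Finset.sum_congr rfl fun i _ => ?_
    rw [ContinuousMap.smul_apply, smul_eq_mul, dualFun_apply, mul_comm, Finset.mul_sum]
    exact Finset.sum_congr rfl fun j _ => by ring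
  ext F z
  change proj hab N n (sliceX (extY Q F) z.2) z.1 = Q (sliceY (extX (proj hab N n) F) z.1) z.2
  have h : sliceY (extX (proj hab N n) F) z.1 =
      ∑ i : Fin (n + 1), ∑ j, (dualBasis hab N n i z.1 *
        (colloc hab N)⁻¹ (gridIdx N n i) j) • sliceY F (node hab N j) := by
    ext y
    change proj hab N n (sliceX F y) z.1 = _
    rw [hw]
    simp only [ContinuousMap.sum_apply, ContinuousMap.smul_apply, smul_eq_mul]
    rfl
  rw [h, hw]
  simp only [map_sum, map_smul, ContinuousMap.sum_apply, ContinuousMap.smul_apply, smul_eq_mul]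
  rfl

/-! ### Iterated Boolean sums of chains of projectors -/

theorem sum_castSucc_sub_succ {A : Type*} [AddCommGroup A] {s : ℕ} (Q : Fin (s + 1) → A) :
    ∑ k : Fin s, (Q k.castSucc - Q k.succ) = Q 0 - Q (Fin.last s) := by
  have h := (Fin.sum_univ_succ Q).symm.trans (Fin.sum_univ_castSucc Q)
  rw [Finset.sum_sub_distrib, sub_eq_sub_iff_add_eq_add, ← h, add_comm]

section Boolean

variable {E : Type*} [NormedAddCommGroup E] [NormedSpace ℝ E]

theorem boolSum_eq (A B : E →L[ℝ] E) : boolSum A B = A + B - A * B :=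
  rfl

/-- The iterated Boolean sum of the products of an increasing chain `P` and a decreasing chain
`Q` of commuting projectors telescopes: prefixing a term to the sum `S` of the later ones
adds `P₀Q₀ - P₀Q₀S`, and `P₀Q₀S = P₀Q₁`. -/
theorem foldr_boolSum_ofFn {s : ℕ} (P : Fin s → E →L[ℝ] E) (Q : Fin (s + 1) → E →L[ℝ] E)
    (hP : ∀ i j, i ≤ j → P i * P j = P i) (hQ : ∀ i j, i ≤ j → Q i * Q j = Q j)
    (hPQ : ∀ i j, P i * Q j = Q j * P i) (hlast : Q (Fin.last s) = 0) :
    (List.ofFn fun k => (P k).comp (Q k.castSucc)).foldr boolSum 0 =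
      ∑ k, P k * (Q k.castSucc - Q k.succ) := by
  induction s with
  | zero => simp
  | succ s ih =>
    have h := ih (fun k => P k.succ) (fun k => Q k.succ)
      (fun i j hij => hP _ _ (Fin.succ_le_succ_iff.2 hij))
      (fun i j hij => hQ _ _ (Fin.succ_le_succ_iff.2 hij))
      (fun i j => hPQ _ _) (by rw [Fin.succ_last, hlast])
    have hmul : P 0 * Q 0 * ∑ k : Fin s, P k.succ * (Q k.castSucc.succ - Q k.succ.succ) =
        P 0 * Q 1 := by
      calc _ = P 0 * ∑ k : Fin s, (Q k.castSucc.succ - Q k.succ.succ) := by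
            rw [Finset.mul_sum, Finset.mul_sum]
            refine Finset.sum_congr rfl fun k _ => ?_
            rw [hPQ 0 0, mul_assoc, ← mul_assoc (P 0), hP _ _ (Fin.zero_le _), ← mul_assoc,
              ← hPQ 0 0, mul_assoc, mul_sub, hQ _ _ (Fin.zero_le _), hQ _ _ (Fin.zero_le _)]
        _ = _ := by
            rw [sum_castSucc_sub_succ fun k : Fin (s + 1) => Q k.succ, Fin.succ_last, hlast]
            simp
    rw [List.ofFn_succ, List.foldr_cons, Fin.sum_univ_succ]
    simp only [← Fin.succ_castSucc] at h ⊢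
    rw [h]
    change P 0 * Q 0 + _ - P 0 * Q 0 * _ = P 0 * (Q 0 - Q 1) + _
    rw [hmul, mul_sub]
    abel

/-- The remainder of the iterated Boolean sum in terms of the remainders of the simple Boolean
sums `P_k ⊕ Q_l`, whose complements are the products `(1 - P_k)(1 - Q_l)`. -/
theorem one_sub_sum_mul_sub {s : ℕ} (p q : Fin (s + 1) → E →L[ℝ] E) (hp : p 0 = 0)
    (hq : q (Fin.last s) = 0) :
    1 - ∑ k : Fin s, p k.succ * (q k.castSucc - q k.succ) =
      ∑ k, (1 - p k) * (1 - q k) - ∑ k : Fin s, (1 - p k.succ) * (1 - q k.castSucc) := by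
  rw [Fin.sum_univ_succ, hp, add_sub_assoc, ← Finset.sum_sub_distrib]
  have h : ∀ k : Fin s, (1 - p k.succ) * (1 - q k.succ) - (1 - p k.succ) * (1 - q k.castSucc) =
      (q k.castSucc - q k.succ) - p k.succ * (q k.castSucc - q k.succ) := fun k => by
    noncomm_ring
  rw [Finset.sum_congr rfl fun k _ => h k, Finset.sum_sub_distrib, sum_castSucc_sub_succ, hq]
  simp only [sub_zero, one_mul]
  abel

theorem norm_boolSum_le {A B : E →L[ℝ] E} {α β : ℝ} (hA : ‖A‖ ≤ α) (hB : ‖B‖ ≤ β) :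
    ‖boolSum A B‖ ≤ α + β + α * β := by
  have h : ‖A * B‖ ≤ α * β := (norm_mul_le A B).trans
    (mul_le_mul hA hB (norm_nonneg _) ((norm_nonneg _).trans hA))
  exact (norm_sub_le _ _).trans (add_le_add ((norm_add_le _ _).trans (add_le_add hA hB)) h)

end Boolean

/-! ### The remainder of a Boolean sum of projectors -/

section Remainder

variable {a b c d : ℝ} {hab : a < b} {hcd : c < d} {p q : ℕ} {G : Rect a b c d → ℝ}

theorem IsCpq.hasDerivWithinAt_fst (hG : IsCpq hab hcd p q G) {i j : ℕ} (hi : i < p) (hj : j ≤ q)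
    (y : Icc c d) {t : ℝ} (ht : t ∈ Icc a b) :
    HasDerivWithinAt (fun s => mixed hab hcd G i j (projIcc a b hab.le s, y))
      (mixed hab hcd G (i + 1) j (projIcc a b hab.le t, y)) (Icc a b) t := by
  rw [projIcc_of_mem hab.le ht]
  exact hG.2.1 i hi j hj (⟨t, ht⟩, y)

theorem IsCpq.hasDerivWithinAt_snd (hG : IsCpq hab hcd p q G) {i j : ℕ} (hi : i ≤ p) (hj : j < q)
    (x : Icc a b) {t : ℝ} (ht : t ∈ Icc c d) :
    HasDerivWithinAt (fun s => mixed hab hcd G i j (x, projIcc c d hcd.le s))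
      (mixed hab hcd G i (j + 1) (x, projIcc c d hcd.le t)) (Icc c d) t := by
  rw [projIcc_of_mem hcd.le ht]
  exact hG.2.2 i hi j hj (x, ⟨t, ht⟩)

theorem supNorm_nonneg (G : Rect a b c d → ℝ) : 0 ≤ supNorm G :=
  Real.iSup_nonneg fun _ => abs_nonneg _

theorem abs_le_supNorm (hG : Continuous G) (z : Rect a b c d) : |G z| ≤ supNorm G :=
  le_ciSup (f := fun z => |G z|) (isCompact_range hG.abs).bddAbove z

/-- The `i`-th derivative in the first variable of the remainder of the Taylor polynomial of
degree less than `N` in the second variable, centred at `y₀`. -/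
noncomputable def taylorRemY (hab : a < b) (hcd : c < d) (G : Rect a b c d → ℝ) (N : ℕ)
    (y₀ : Icc c d) (i : ℕ) (z : Rect a b c d) : ℝ :=
  mixed hab hcd G i 0 z - ∑ j ∈ Finset.range N,
    mixed hab hcd G i j (z.1, y₀) * (((z.2 : ℝ) - y₀) ^ j / (j.factorial : ℝ))

theorem continuous_taylorRemY (hG : IsCpq hab hcd p q G) {N i : ℕ} (hN : N ≤ q) (hi : i ≤ p)
    (y₀ : Icc c d) : Continuous (taylorRemY hab hcd G N y₀ i) := by
  refine (hG.1 i hi 0 (Nat.zero_le _)).sub (continuous_finsetSum _ fun j hj => ?_)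
  have h := hG.1 i hi j ((Finset.mem_range.1 hj).le.trans hN)
  fun_prop

theorem abs_taylorRemY_le (hG : IsCpq hab hcd p q G) {M N : ℕ} (hM : M ≤ p) (hN : N ≤ q)
    (y₀ : Icc c d) (z : Rect a b c d) :
    |taylorRemY hab hcd G N y₀ M z| ≤ supNorm (mixed hab hcd G M N) *
      (|(z.2 : ℝ) - y₀| ^ N / (N.factorial : ℝ)) := by
  have h := abs_sub_taylor_le (M := N)
    (f := fun j s => mixed hab hcd G M j (z.1, projIcc c d hcd.le s)) y₀.2
    (fun j hj t ht => hG.hasDerivWithinAt_snd hM (hj.trans_le hN) z.1 ht)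
    (fun t _ => abs_le_supNorm (hG.1 M hM N hN) _) z.2.2
  simp only [projIcc_val] at h
  exact h

/-- The remainder of the blended Taylor polynomial, centred at `(x₀, y₀)`: expanding in each
variable in turn leaves only the mixed derivative of order `(M, N)`. -/
theorem abs_blended_taylor_le (hG : IsCpq hab hcd p q G) {M N : ℕ} (hM : M ≤ p) (hN : N ≤ q)
    (x₀ : Icc a b) (y₀ : Icc c d) (z : Rect a b c d) :
    |taylorRemY hab hcd G N y₀ 0 z - ∑ i ∈ Finset.range M,
      taylorRemY hab hcd G N y₀ i (x₀, z.2) * (((z.1 : ℝ) - x₀) ^ i / (i.factorial : ℝ))| ≤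
    supNorm (mixed hab hcd G M N) * (|(z.2 : ℝ) - y₀| ^ N / (N.factorial : ℝ)) *
      (|(z.1 : ℝ) - x₀| ^ M / (M.factorial : ℝ)) := by
  have h := abs_sub_taylor_le (M := M)
    (C := supNorm (mixed hab hcd G M N) * (|(z.2 : ℝ) - y₀| ^ N / (N.factorial : ℝ)))
    (f := fun i s => taylorRemY hab hcd G N y₀ i (projIcc a b hab.le s, z.2)) x₀.2
    (fun i hi t ht => (hG.hasDerivWithinAt_fst (hi.trans_le hM) (Nat.zero_le _) z.2 ht).sub
      (HasDerivWithinAt.fun_sum fun j hj => (hG.hasDerivWithinAt_fst (hi.trans_le hM)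
        ((Finset.mem_range.1 hj).le.trans hN) y₀ ht).mul_const
          (((z.2 : ℝ) - y₀) ^ j / (j.factorial : ℝ))))
    (fun t _ => abs_taylorRemY_le hG hM hN y₀ (projIcc a b hab.le t, z.2)) z.1.2
  simp only [projIcc_val] at h
  exact h

/-- The blended Taylor polynomial at the centre of the square is annihilated by `(1 - A)(1 - B)`
as soon as `A` and `B` commute and reproduce the powers of the first and the second variable. -/
theorem norm_one_sub_mul_one_sub_le {h : ℝ} (hx : b - a = h) (hy : d - c = h)
    {F : C(Rect a b c d, ℝ)} (hF : IsCpq hab hcd p q F) {M N : ℕ} (hM : M ≤ p) (hN : N ≤ q)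
    {A B : C(Rect a b c d, ℝ) →L[ℝ] C(Rect a b c d, ℝ)} (hAB : A * B = B * A)
    (hA : ∀ i < M, ∀ (x₀ : ℝ) (g : C(Icc c d, ℝ)) (G : C(Rect a b c d, ℝ)),
      (∀ z, G z = ((z.1 : ℝ) - x₀) ^ i * g z.2) → A G = G)
    (hB : ∀ j < N, ∀ (y₀ : ℝ) (g : C(Icc a b, ℝ)) (G : C(Rect a b c d, ℝ)),
      (∀ z, G z = g z.1 * ((z.2 : ℝ) - y₀) ^ j) → B G = G) :
    ‖((1 - A) * (1 - B)) F‖ ≤ (1 + ‖boolSum A B‖) *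
      (supNorm (mixed hab hcd F M N) /
        (2 ^ (M + N) * (M.factorial : ℝ) * (N.factorial : ℝ))) * h ^ (M + N) := by
  have hh : 0 < h := by linarith
  let x₀ : Icc a b := ⟨(a + b) / 2, by constructor <;> linarith⟩
  let y₀ : Icc c d := ⟨(c + d) / 2, by constructor <;> linarith⟩
  let R := taylorRemY hab hcd F N y₀
  have hR : ∀ i, Continuous (fun y => R (min i p) (x₀, y)) := fun i =>
    (continuous_taylorRemY hF hN (min_le_right i p) y₀).comp (by fun_prop)
  have hD : ∀ j, Continuous (fun x => mixed hab hcd F 0 (min j q) (x, y₀)) := fun j =>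
    (hF.1 0 (Nat.zero_le _) _ (min_le_right j q)).comp (by fun_prop)
  -- the orders are capped at `p` and `q`, so that every summand is a continuous function
  let gX : ℕ → C(Rect a b c d, ℝ) := fun i =>
    ⟨fun z => ((z.1 : ℝ) - x₀) ^ i * (R (min i p) (x₀, z.2) / (i.factorial : ℝ)),
      Continuous.mul (by fun_prop) (((hR i).comp continuous_snd).div_const _)⟩
  let gY : ℕ → C(Rect a b c d, ℝ) := fun j =>
    ⟨fun z => mixed hab hcd F 0 (min j q) (z.1, y₀) / (j.factorial : ℝ) *
      ((z.2 : ℝ) - y₀) ^ j,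
      (((hD j).comp continuous_fst).div_const _).mul (by fun_prop)⟩
  have hgX : ∀ i < M, A (gX i) = gX i := fun i hi =>
    hA i hi x₀ ⟨fun y => R (min i p) (x₀, y) / (i.factorial : ℝ), (hR i).div_const _⟩ _
      fun z => rfl
  have hgY : ∀ j < N, B (gY j) = gY j := fun j hj =>
    hB j hj y₀ ⟨fun x => mixed hab hcd F 0 (min j q) (x, y₀) / (j.factorial : ℝ),
      (hD j).div_const _⟩ _ fun z => rfl
  let GX := ∑ i ∈ Finset.range M, gX i
  let GY := ∑ j ∈ Finset.range N, gY j
  have hGX : A GX = GX := by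
    rw [map_sum]
    exact Finset.sum_congr rfl fun i hi => hgX i (Finset.mem_range.1 hi)
  have hGY : B GY = GY := by
    rw [map_sum]
    exact Finset.sum_congr rfl fun j hj => hgY j (Finset.mem_range.1 hj)
  have hBA : ∀ G, A (B G) = B (A G) := fun G => congrArg (fun T => T G) hAB
  have hbool : ∀ G, boolSum A B G = A G + B G - A (B G) := fun _ => rfl
  have hexp : ∀ G, ((1 - A) * (1 - B)) G = G - boolSum A B G := by
    intro G
    have h1 : (1 - A) * (1 - B) = 1 - boolSum A B := by
      rw [boolSum_eq, mul_sub, mul_one, sub_mul, one_mul]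
      abel
    rw [h1]
    rfl
  have hann : ((1 - A) * (1 - B)) F = ((1 - A) * (1 - B)) (F - GY - GX) := by
    rw [map_sub, map_sub, hexp GY, hexp GX, hbool, hbool, hBA GX, hGX, hGY]
    abel
  have hnorm : ‖F - GY - GX‖ ≤ supNorm (mixed hab hcd F M N) /
      (2 ^ (M + N) * (M.factorial : ℝ) * (N.factorial : ℝ)) * h ^ (M + N) := by
    have hS := supNorm_nonneg (mixed hab hcd F M N)
    refine (ContinuousMap.norm_le _ (by positivity)).2 fun z => ?_
    have e : (F - GY - GX) z = R 0 z - ∑ i ∈ Finset.range M,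
        R i (x₀, z.2) * (((z.1 : ℝ) - x₀) ^ i / (i.factorial : ℝ)) := by
      have e1 : GY z = ∑ j ∈ Finset.range N,
          mixed hab hcd F 0 j (z.1, y₀) * (((z.2 : ℝ) - y₀) ^ j / (j.factorial : ℝ)) := by
        rw [ContinuousMap.sum_apply]
        refine Finset.sum_congr rfl fun j hj => ?_
        change mixed hab hcd F 0 (min j q) (z.1, y₀) / _ * _ = _
        rw [min_eq_left ((Finset.mem_range.1 hj).le.trans hN)]
        ring
      have e2 : GX z = ∑ i ∈ Finset.range M,
          R i (x₀, z.2) * (((z.1 : ℝ) - x₀) ^ i / (i.factorial : ℝ)) := by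
        rw [ContinuousMap.sum_apply]
        refine Finset.sum_congr rfl fun i hi => ?_
        change _ * (R (min i p) (x₀, z.2) / _) = _
        rw [min_eq_left ((Finset.mem_range.1 hi).le.trans hM)]
        ring
      rw [ContinuousMap.sub_apply, ContinuousMap.sub_apply, e1, e2]
      rfl
    rw [e, Real.norm_eq_abs]
    refine (abs_blended_taylor_le hF hM hN x₀ y₀ z).trans ?_
    have hzx : |(z.1 : ℝ) - x₀| ≤ h / 2 := abs_le.2
      ⟨by linarith [z.1.2.1, show (x₀ : ℝ) = (a + b) / 2 from rfl],
        by linarith [z.1.2.2, show (x₀ : ℝ) = (a + b) / 2 from rfl]⟩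
    have hzy : |(z.2 : ℝ) - y₀| ≤ h / 2 := abs_le.2
      ⟨by linarith [z.2.2.1, show (y₀ : ℝ) = (c + d) / 2 from rfl],
        by linarith [z.2.2.2, show (y₀ : ℝ) = (c + d) / 2 from rfl]⟩
    calc _ ≤ supNorm (mixed hab hcd F M N) * ((h / 2) ^ N / (N.factorial : ℝ)) *
          ((h / 2) ^ M / (M.factorial : ℝ)) := by gcongr
      _ = _ := by
          rw [div_pow, div_pow, pow_add, pow_add]
          field_simp
  rw [hann, hexp, mul_assoc]
  calc _ ≤ ‖F - GY - GX‖ + ‖boolSum A B‖ * ‖F - GY - GX‖ :=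
        (norm_sub_le _ _).trans (add_le_add_right (ContinuousLinearMap.le_opNorm _ _) _)
    _ = (1 + ‖boolSum A B‖) * ‖F - GY - GX‖ := by ring
    _ ≤ _ := mul_le_mul_of_nonneg_left hnorm (by positivity)

end Remainder

/-! ### The chains of projectors -/

section Chains

variable {r : ℕ} {m n : Fin (r + 1) → ℕ} {a b c d : ℝ}

theorem dvd_of_le_of_forall_dvd_succ (hmd : ∀ k : Fin r, m k.castSucc ∣ m k.succ)
    {i j : Fin (r + 1)} (hij : i ≤ j) : m i ∣ m j := by
  rcases hij.eq_or_lt with rfl | h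
  · exact dvd_rfl
  · exact (Fin.liftFun_iff_succ (· ∣ ·)).2 hmd h

theorem projXs_mul_of_le (hab : a < b) (hm : StrictMono m)
    (hmd : ∀ k : Fin r, m k.castSucc ∣ m k.succ) {i j : Fin (r + 1)} (hij : i ≤ j) :
    (projXs (c := c) (d := d) hab m i.succ) * projXs hab m j.succ = projXs hab m i.succ := by
  simp only [projXs, Fin.cons_succ, projX]
  rw [extX_mul, proj_comp_proj_of_dvd hab (dvd_of_le_of_forall_dvd_succ hmd hij)
    (dvd_of_le_of_forall_dvd_succ hmd (Fin.le_last j)) (hm.monotone hij)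
    (hm.monotone (Fin.le_last j))]

theorem projYs_mul_of_le (hcd : c < d) (hn : StrictMono n) {i j : Fin (r + 2)} (hij : i ≤ j) :
    (projYs (a := a) (b := b) hcd n j) * projYs hcd n i = projYs hcd n i := by
  cases i using Fin.cases with
  | zero => simp [projYs]
  | succ i =>
    cases j using Fin.cases with
    | zero => exact absurd hij (by simp)
    | succ j =>
      simp only [projYs, Fin.cons_succ, projY]
      rw [extY_mul, proj_comp_proj_of_le hcd (hn.monotone (Fin.succ_le_succ_iff.1 hij))
        (hn.monotone (Fin.le_last j))]

theorem projXs_mul_projYs (hab : a < b) (hcd : c < d) (k l : Fin (r + 2)) :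
    projXs hab m k * projYs hcd n l = projYs hcd n l * projXs hab m k := by
  cases k using Fin.cases with
  | zero => simp [projXs]
  | succ k =>
    cases l using Fin.cases with
    | zero => simp [projYs]
    | succ l => exact projX_mul_extY hab _ _ _

theorem projXs_apply_sub_pow_mul (hab : a < b) (hm : StrictMono m) (k : Fin (r + 2)) {i : ℕ}
    (hi : i < ord m k) (x₀ : ℝ) (g : C(Icc c d, ℝ)) (G : C(Rect a b c d, ℝ))
    (hG : ∀ z, G z = ((z.1 : ℝ) - x₀) ^ i * g z.2) : projXs hab m k G = G := by
  cases k using Fin.cases with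
  | zero => exact absurd hi (by simp [ord])
  | succ k =>
    exact extX_apply_of_eq_mul _ ⟨fun x : Icc a b => ((x : ℝ) - x₀) ^ i, by fun_prop⟩ g G hG
      (proj_sub_pow hab (hm.monotone (Fin.le_last k)) (Nat.lt_succ_iff.1 hi) x₀ _ fun _ => rfl)

theorem projYs_apply_mul_sub_pow (hcd : c < d) (hn : StrictMono n) (l : Fin (r + 2)) {j : ℕ}
    (hj : j < ord n l) (y₀ : ℝ) (g : C(Icc a b, ℝ)) (G : C(Rect a b c d, ℝ))
    (hG : ∀ z, G z = g z.1 * ((z.2 : ℝ) - y₀) ^ j) : projYs hcd n l G = G := by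
  cases l using Fin.cases with
  | zero => exact absurd hj (by simp [ord])
  | succ l =>
    exact extY_apply_of_eq_mul _ g ⟨fun y : Icc c d => ((y : ℝ) - y₀) ^ j, by fun_prop⟩ G hG
      (proj_sub_pow hcd (hn.monotone (Fin.le_last l)) (Nat.lt_succ_iff.1 hj) y₀ _ fun _ => rfl)

theorem norm_projXs_le (hab : a < b) (m : Fin (r + 1) → ℕ) (k : Fin (r + 2)) :
    ‖projXs (c := c) (d := d) hab m k‖ ≤ projConsts m k := by
  cases k using Fin.cases with
  | zero => exact (norm_zero (E := C(Rect a b c d, ℝ) →L[ℝ] C(Rect a b c d, ℝ))).le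
  | succ k => exact (norm_extX_le _).trans (norm_proj_le hab _ _)

theorem norm_projYs_le (hcd : c < d) (n : Fin (r + 1) → ℕ) (l : Fin (r + 2)) :
    ‖projYs (a := a) (b := b) hcd n l‖ ≤ projConsts n l := by
  cases l using Fin.cases with
  | zero => exact (norm_zero (E := C(Rect a b c d, ℝ) →L[ℝ] C(Rect a b c d, ℝ))).le
  | succ l => exact (norm_extY_le _).trans (norm_proj_le hcd _ _)

/-! ### The remainder of the blended projector -/

theorem one_sub_blend (hab : a < b) (hcd : c < d) (hm : StrictMono m) (hn : StrictMono n)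
    (hmd : ∀ k : Fin r, m k.castSucc ∣ m k.succ) :
    1 - blend hab hcd m n =
      ∑ k : Fin (r + 2), (1 - projXs hab m k) * (1 - projYs hcd n k.rev) -
        ∑ k : Fin (r + 1), (1 - projXs hab m k.succ) * (1 - projYs hcd n k.rev.succ) := by
  have h0 : projYs (a := a) (b := b) hcd n (Fin.last (r + 1)).rev = 0 := by
    rw [Fin.rev_last]
    rfl
  have h := foldr_boolSum_ofFn (fun k : Fin (r + 1) => projXs (c := c) (d := d) hab m k.succ)
    (fun k => projYs hcd n k.rev) (fun i j hij => projXs_mul_of_le hab hm hmd hij)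
    (fun i j hij => projYs_mul_of_le hcd hn (Fin.rev_le_rev.2 hij))
    (fun i j => projXs_mul_projYs hab hcd _ _) h0
  have hblend : blend hab hcd m n = ∑ k : Fin (r + 1), projXs hab m k.succ *
      (projYs hcd n k.castSucc.rev - projYs hcd n k.succ.rev) := by
    rw [← h]
    simp only [Fin.rev_castSucc]
    rfl
  rw [hblend, one_sub_sum_mul_sub (projXs hab m) (fun k => projYs hcd n k.rev) rfl h0]
  simp only [Fin.rev_castSucc]

theorem ord_le (hm : StrictMono m) (k : Fin (r + 2)) : ord m k ≤ m (Fin.last r) + 1 := by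
  cases k using Fin.cases with
  | zero => simp [ord]
  | succ k => simpa [ord] using hm.monotone (Fin.le_last k)

theorem ord_castSucc_le_succ (hm : StrictMono m) (k : Fin (r + 1)) :
    ord m k.castSucc ≤ ord m k.succ := by
  cases k using Fin.cases with
  | zero => simp [ord]
  | succ k =>
    have := hm (Fin.castSucc_lt_succ (i := k))
    rw [← Fin.succ_castSucc]
    simp only [ord, Fin.cons_succ]
    omega

theorem approxOrder_le (m n : Fin (r + 1) → ℕ) (k : Fin (r + 2)) :
    approxOrder m n ≤ ord m k + ord n k.rev :=
  Finset.inf'_le _ (Finset.mem_univ k)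

theorem norm_sub_projXs_projYs_le {h : ℝ} {hab : a < b} {hcd : c < d} (hx : b - a = h)
    (hy : d - c = h) (h1 : h ≤ 1) (hm : StrictMono m) (hn : StrictMono n)
    {F : C(Rect a b c d, ℝ)}
    (hF : IsCpq hab hcd (m (Fin.last r) + 1) (n (Fin.last r) + 1) F) {k l : Fin (r + 2)}
    (hkl : approxOrder m n ≤ ord m k + ord n l) :
    ‖((1 - projXs hab m k) * (1 - projYs hcd n l) :
      C(Rect a b c d, ℝ) →L[ℝ] C(Rect a b c d, ℝ)) F‖ ≤
      boolConst hab hcd m n F k l * h ^ approxOrder m n := by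
  have hh : 0 ≤ h := by linarith
  refine (norm_one_sub_mul_one_sub_le hx hy hF (ord_le hm k) (ord_le hn l)
    (projXs_mul_projYs hab hcd k l)
    (fun i hi x₀ g G hG => projXs_apply_sub_pow_mul hab hm k hi x₀ g G hG)
    (fun j hj y₀ g G hG => projYs_apply_mul_sub_pow hcd hn l hj y₀ g G hG)).trans ?_
  have hS := supNorm_nonneg (mixed hab hcd F (ord m k) (ord n l))
  exact mul_le_mul_of_nonneg_left (pow_le_pow_of_le_one hh h1 hkl) (by positivity)

end Chains

end DiscreteBlending

theorem mainTheorem1 (r : ℕ) (m n : Fin (r + 1) → ℕ)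
    (hm : StrictMono m) (hn : StrictMono n)
    (hmd : ∀ k : Fin r, m k.castSucc ∣ m k.succ) (hnd : ∀ k : Fin r, n k.castSucc ∣ n k.succ)
    (a b c d h : ℝ) (hab : a < b) (hcd : c < d) (hx : b - a = h) (hy : d - c = h)
    (F : C(DiscreteBlending.Rect a b c d, ℝ))
    (hF : DiscreteBlending.IsCpq hab hcd (m (Fin.last r) + 1) (n (Fin.last r) + 1) F) :
    (h ≤ 1 → ‖F - DiscreteBlending.blend hab hcd m n F‖ ≤
        DiscreteBlending.blendConst hab hcd m n F * h ^ DiscreteBlending.approxOrder m n) ∧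
      ∀ k l : Fin (r + 2),
        ‖DiscreteBlending.boolSum
            (DiscreteBlending.projXs (c := c) (d := d) hab m k)
            (DiscreteBlending.projYs (a := a) (b := b) hcd n l)‖ ≤
          DiscreteBlending.projConsts m k + DiscreteBlending.projConsts n l +
            DiscreteBlending.projConsts m k * DiscreteBlending.projConsts n l := by
  refine ⟨fun h1 => ?_, fun k l => DiscreteBlending.norm_boolSum_le
    (DiscreteBlending.norm_projXs_le hab m k) (DiscreteBlending.norm_projYs_le hcd n l)⟩
  have e : F - DiscreteBlending.blend hab hcd m n F =
      (1 - DiscreteBlending.blend hab hcd m n) F := rfl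
  rw [e, DiscreteBlending.one_sub_blend hab hcd hm hn hmd, sub_apply, sum_apply, sum_apply,
    DiscreteBlending.blendConst, add_mul, Finset.sum_mul, Finset.sum_mul]
  refine (norm_sub_le _ _).trans (add_le_add
    (norm_sum_le_of_le _ fun k _ => ?_) (norm_sum_le_of_le _ fun k _ => ?_))
  · exact DiscreteBlending.norm_sub_projXs_projYs_le hx hy h1 hm hn hF
      (DiscreteBlending.approxOrder_le m n k)
  · refine DiscreteBlending.norm_sub_projXs_projYs_le hx hy h1 hm hn hF ?_
    refine (DiscreteBlending.approxOrder_le m n k.castSucc).trans ?_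
    rw [Fin.rev_castSucc]
    exact Nat.add_le_add_right (DiscreteBlending.ord_castSucc_le_succ hm k) _
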